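/- Let $\Sigma$ be a finite alphabet. For a right-infinite word $v$ over $\Sigma$, let $\mathrm{Fac}(v)$ be the set of its factors (finite contiguous subwords), and let $p_v(n)$ be the number of factors of $v$ of length $n$. Call two right-infinite words equivalent if they have the same set of factors, write $[v]$ for the equivalence class of $v$, and put $[v]\preceq[v']$ if $\mathrm{Fac}(v)\supseteq\mathrm{Fac}(v')$. A word $v$ is recurrent if each of its factors occurs infinitely often in $v$, and uniformly recurrent if for each factor $u$ of $v$ there is some $N$ such that every factor of $v$ of length $N$ contains $u$ as a factor. For a right-infinite word $w$ over $\Sigma$ define $$\mathrm{Rec}(w)=\{[v]\colon v \text{ recurrent},\ [w]\preceq[v]\},\qquad \mathrm{URec}(w)=\{[v]\colon v \text{ uniformly recurrent},\ [w]\preceq[v]\}.$$ Theorem. Let $w$ be a right-infinite word over $\Sigma$ and suppose that $C$ is a real constant such that $p_w(n)\le Cn$ for all $n\ge 1$. Then $\mathrm{Rec}(w)$ and $\mathrm{URec}(w)$ are finite, and $$\#\mathrm{Rec}(w)\le \limsup_{n\to\infty}\bigl(p_w(n+1)-p_w(n)\bigr)+\bigl(\lceil C\rceil!\bigr)^2,$$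 $$\#\mathrm{URec}(w)\le \limsup_{n\to\infty}\bigl(p_w(n+1)-p_w(n)\bigr)+1+C^2,$$ where the upper limits are taken in the extended real numbers. -/

import Mathlib

namespace InfWord

/-- The finite word of length `n` read off the right-infinite word `w` from position `i` on. -/
def factorAt {α : Type*} (w : ℕ → α) (i n : ℕ) : List α :=
  List.ofFn fun j : Fin n => w (i + j)

/-- `Fac w`: the set of factors (finite contiguous subwords, the empty one included) of the
right-infinite word `w`. -/
def Fac {α : Type*} (w : ℕ → α) : Set (List α) :=
  {u | ∃ i, factorAt w i u.length = u}

/-- The factor complexity function `p_w`: the number of distinct factors of `w` of length `n`. -/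
noncomputable def complexity {α : Type*} (w : ℕ → α) (n : ℕ) : ℕ :=
  {u | u ∈ Fac w ∧ u.length = n}.ncard

/-- `w` is recurrent: each factor of `w` occurs at infinitely many positions of `w`. -/
def Recurrent {α : Type*} (w : ℕ → α) : Prop :=
  ∀ u ∈ Fac w, {i | factorAt w i u.length = u}.Infinite

/-- `w` is uniformly recurrent: for each factor `u` of `w` there is some `N` such that every
factor of `w` of length `N` contains `u` as a contiguous subword. -/
def UniformlyRecurrent {α : Type*} (w : ℕ → α) : Prop :=
  ∀ u ∈ Fac w, ∃ N : ℕ, ∀ v ∈ Fac w, v.length = N → u <:+: v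

/-- Two right-infinite words are equivalent when they have the same set of factors. -/
def facSetoid (α : Type*) : Setoid (ℕ → α) where
  r w w' := Fac w = Fac w'
  iseqv := ⟨fun _ => rfl, fun h => h.symm, fun h h' => h.trans h'⟩

/-- The set of equivalence classes of right-infinite words over `α`. -/
def WordClass (α : Type*) : Type _ := Quotient (facSetoid α)

/-- The class `[w]` of a right-infinite word `w`. -/
def cls {α : Type*} (w : ℕ → α) : WordClass α := Quotient.mk (facSetoid α) w

/-- The common factor set of the members of a class. -/
def WordClass.fac {α : Type*} (c : WordClass α) : Set (List α) :=
  Quotient.lift (s := facSetoid α) Fac (fun _ _ h => h) c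

theorem WordClass.fac_injective {α : Type*} :
    Function.Injective (WordClass.fac : WordClass α → Set (List α)) := by
  intro a b h
  induction a using Quotient.inductionOn with | _ w =>
  induction b using Quotient.inductionOn with | _ w' =>
  exact Quotient.sound (s := facSetoid α) h

/-- The order on classes: `[w] ≤ [w']` if and only if `Fac w ⊇ Fac w'`. -/
instance {α : Type*} : PartialOrder (WordClass α) where
  le a b := b.fac ⊆ a.fac
  le_refl _ := Set.Subset.rfl
  le_trans _ _ _ h h' := Set.Subset.trans h' h
  le_antisymm _ _ h h' := WordClass.fac_injective (Set.Subset.antisymm h' h)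

/-- The recurrent spectrum `Rec(w) = {[v] : v recurrent, [w] ≤ [v]}`. -/
def RecSpec {α : Type*} (w : ℕ → α) : Set (WordClass α) :=
  {c | ∃ v : ℕ → α, Recurrent v ∧ cls w ≤ cls v ∧ c = cls v}

/-- The uniformly recurrent spectrum
`URec(w) = {[v] : v uniformly recurrent, [w] ≤ [v]}`. -/
def URecSpec {α : Type*} (w : ℕ → α) : Set (WordClass α) :=
  {c | ∃ v : ℕ → α, UniformlyRecurrent v ∧ cls w ≤ cls v ∧ c = cls v}

/-- `limsup (p_w (n+1) - p_w n)` as `n → ∞`, taken in the extended reals. -/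
noncomputable def limsupDiff {α : Type*} (w : ℕ → α) : EReal :=
  Filter.limsup (fun n : ℕ => (((complexity w (n + 1) : ℝ) - (complexity w n : ℝ) : ℝ) : EReal))
    Filter.atTop

end InfWord

/-! Let `d` be the lower limit of `p_w(n+1) - p_w(n)`. Linear growth gives `d ≤ C`, and `d` is at
most the upper limit. Given finitely many classes, choose a large `n` at which this difference
equals `d` and at which length-`n` factors already tell the classes apart.

View factors of length `n` as vertices and factors of length `n + 1` as edges (the Rauzy graph). A
uniformly recurrent word meeting another word in a long factor is contained in it, so distinct
uniformly recurrent classes occupy disjoint vertex sets. At most one of these sets lacks a right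
special vertex, since `w` can never leave such a set. Hence there are at most `d + 1` uniformly
recurrent classes (`card_le_coreExcess_add_one`).

Any other recurrent word contains a uniformly recurrent one (`exists_uniformlyRecurrent`), hence
uses an edge leaving that part of the graph. It is determined by which exits and which branches
outside the core it uses (`level_subset_of_shared_edges`). Splitting `d = e + r` into surplus
extensions inside and outside the core gives at most `e` exits and `2r` branches, hence at most
`(2^e - 1) 4^r` such words. Arithmetic finishes (`add_le_factorial_sq`). -/

namespace InfWord

variable {α : Type*}

/-! ### Factors and recurrence -/

@[simp] theorem length_factorAt (w : ℕ → α) (i n : ℕ) : (factorAt w i n).length = n := by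
  simp [factorAt]

theorem factorAt_mem_Fac (w : ℕ → α) (i n : ℕ) : factorAt w i n ∈ Fac w :=
  ⟨i, by rw [length_factorAt]⟩

theorem exists_factorAt_eq {w : ℕ → α} {u : List α} {n : ℕ} (hu : u ∈ Fac w) (hn : u.length = n) :
    ∃ i, factorAt w i n = u := by
  obtain ⟨i, hi⟩ := hu
  exact ⟨i, hn ▸ hi⟩

theorem factorAt_succ (w : ℕ → α) (i n : ℕ) :
    factorAt w i (n + 1) = factorAt w i n ++ [w (i + n)] := by
  simp only [factorAt, List.ofFn_succ_last, Fin.val_castSucc, Fin.val_last]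

theorem factorAt_add (w : ℕ → α) (i m n : ℕ) :
    factorAt w i (m + n) = factorAt w i m ++ factorAt w (i + m) n := by
  induction n with
  | zero => simp [factorAt]
  | succ n ih =>
    rw [← add_assoc, factorAt_succ, ih, factorAt_succ, List.append_assoc, add_assoc]

@[simp] theorem dropLast_factorAt (w : ℕ → α) (i n : ℕ) :
    (factorAt w i (n + 1)).dropLast = factorAt w i n := by
  simp [factorAt_succ]

theorem mem_Fac_of_infix {w : ℕ → α} {u v : List α} (h : u <:+: v) (hv : v ∈ Fac w) :
    u ∈ Fac w := by
  obtain ⟨s, t, rfl⟩ := h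
  obtain ⟨i, hi⟩ := hv
  rw [List.length_append, List.length_append, factorAt_add, factorAt_add] at hi
  have h1 := (List.append_inj hi (by simp)).1
  exact ⟨i + s.length, (List.append_inj h1 (by simp)).2⟩

theorem dropLast_mem_Fac {w : ℕ → α} {u : List α} (hu : u ∈ Fac w) : u.dropLast ∈ Fac w :=
  mem_Fac_of_infix (List.dropLast_prefix u).isInfix hu

theorem exists_extension {w : ℕ → α} {u : List α} {n : ℕ} (hu : u ∈ Fac w) (hn : u.length = n) :
    ∃ x ∈ Fac w, x.length = n + 1 ∧ x.dropLast = u := by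
  obtain ⟨i, rfl⟩ := exists_factorAt_eq hu hn
  exact ⟨_, factorAt_mem_Fac w i (n + 1), by simp, by simp⟩

theorem tail_factorAt_succ (w : ℕ → α) (i n : ℕ) :
    (factorAt w i (n + 1)).tail = factorAt w (i + 1) n := by
  rw [add_comm n 1, factorAt_add]
  simp [factorAt]

theorem factorAt_succ_mem_of_edge {w : ℕ → α} {v : ℕ → α} {i n : ℕ}
    (h : factorAt w i (n + 1) ∈ Fac v) : factorAt w (i + 1) n ∈ Fac v := by
  rw [← tail_factorAt_succ]
  exact mem_Fac_of_infix (List.tail_suffix _).isInfix h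

theorem Recurrent.exists_ge {w : ℕ → α} (hw : Recurrent w) {u : List α} {n : ℕ}
    (hu : u ∈ Fac w) (hn : u.length = n) (k : ℕ) : ∃ i ≥ k, factorAt w i n = u := by
  obtain ⟨i, hi, hk⟩ := (hw u hu).exists_gt k
  exact ⟨i, hk.le, hn ▸ hi⟩

theorem UniformlyRecurrent.recurrent {w : ℕ → α} (hw : UniformlyRecurrent w) : Recurrent w := by
  intro u hu
  obtain ⟨N, hN⟩ := hw u hu
  rw [Set.infinite_iff_exists_gt]
  intro k
  obtain ⟨s, t, h⟩ := hN _ (factorAt_mem_Fac w (k + 1) N) (by simp)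
  have hlen : N = s.length + u.length + t.length := by
    have := congrArg List.length h
    simp at this; omega
  rw [hlen, factorAt_add, factorAt_add] at h
  have h1 := (List.append_inj h (by simp)).1
  exact ⟨k + 1 + s.length, ((List.append_inj h1 (by simp)).2).symm, by omega⟩

theorem UniformlyRecurrent.exists_forall_infix {w : ℕ → α} (hw : UniformlyRecurrent w)
    {u : List α} (hu : u ∈ Fac w) : ∃ N : ℕ, ∀ v ∈ Fac w, N ≤ v.length → u <:+: v := by
  obtain ⟨N, hN⟩ := hw u hu
  refine ⟨N, fun v hv hle => ?_⟩
  exact (hN _ (mem_Fac_of_infix (List.take_prefix N v).isInfix hv) (by simpa using hle)).trans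
    (List.take_prefix N v).isInfix

/-! ### Uniformly recurrent words by compactness -/

theorem isClopen_setOf_factorAt [TopologicalSpace α] [DiscreteTopology α] (i n : ℕ)
    (S : Set (List α)) : IsClopen {v : ℕ → α | factorAt v i n ∈ S} := by
  have hc : Continuous fun v : ℕ → α => (fun j : Fin n => v (i + j)) := by fun_prop
  have : {v : ℕ → α | factorAt v i n ∈ S} =
      (fun v : ℕ → α => (fun j : Fin n => v (i + j))) ⁻¹' {g | List.ofFn g ∈ S} := rfl
  rw [this]
  exact (isClopen_discrete _).preimage hc

theorem factorAt_shift (w : ℕ → α) (k i n : ℕ) :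
    factorAt (fun j => w (j + k)) i n = factorAt w (i + k) n := by
  simp only [factorAt]
  congr 1; ext j; congr 1; omega

theorem Fac_shift_subset (w : ℕ → α) (k : ℕ) : Fac (fun j => w (j + k)) ⊆ Fac w := by
  rintro u ⟨i, hi⟩
  exact ⟨i + k, by rwa [factorAt_shift] at hi⟩

/-- A minimal nonempty closed shift-invariant set below `{v | Fac v ⊆ Fac w}`. -/
theorem exists_minimal_shift_invariant [TopologicalSpace α] [CompactSpace α] {S : Set (ℕ → α)}
    (hS : IsClosed S) (hne : S.Nonempty) (hinv : ∀ v ∈ S, (fun j => v (j + 1)) ∈ S) :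
    ∃ K ⊆ S, Minimal (fun K : Set (ℕ → α) =>
      IsClosed K ∧ K.Nonempty ∧ ∀ v ∈ K, (fun j => v (j + 1)) ∈ K) K := by
  refine zorn_superset_nonempty {K : Set (ℕ → α) |
      IsClosed K ∧ K.Nonempty ∧ ∀ v ∈ K, (fun j => v (j + 1)) ∈ K} ?_ S ⟨hS, hne, hinv⟩
  intro c hc hchain hcne
  refine ⟨⋂₀ c, ⟨isClosed_sInter fun K hK => (hc hK).1, ?_, ?_⟩, fun K hK => Set.sInter_subset_of_mem hK⟩
  · have := hcne.to_subtype
    exact IsCompact.nonempty_sInter_of_directed_nonempty_isCompact_isClosed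
      (fun A hA B hB => (hchain.total hA hB).elim (fun h => ⟨A, hA, Set.Subset.rfl, h⟩)
        fun h => ⟨B, hB, h, Set.Subset.rfl⟩) (fun K hK => (hc hK).2.1)
      (fun K hK => (hc hK).1.isCompact) (fun K hK => (hc hK).1)
  · intro v hv K hK
    exact (hc hK).2.2 v (hv K hK)

/-- Any point of a minimal subshift is uniformly recurrent: if arbitrarily long factors avoided `u`,
a limit point would avoid `u` altogether, and the points avoiding `u` would form a smaller subshift.
-/
theorem exists_uniformlyRecurrent [Finite α] (w : ℕ → α) :
    ∃ m : ℕ → α, UniformlyRecurrent m ∧ Fac m ⊆ Fac w := by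
  let : TopologicalSpace α := ⊥
  have : DiscreteTopology α := ⟨rfl⟩
  have hcl : ∀ A : Set (List α), IsClosed {v : ℕ → α | Fac v ⊆ A} := by
    intro A
    have : {v : ℕ → α | Fac v ⊆ A} = ⋂ i, ⋂ n, {v : ℕ → α | factorAt v i n ∈ A} := by
      ext v
      simp only [Set.mem_ofPred_eq, Set.mem_iInter]
      exact ⟨fun h i n => h (factorAt_mem_Fac v i n), fun h u ⟨i, hi⟩ => hi ▸ h i _⟩
    rw [this]
    exact isClosed_iInter fun i => isClosed_iInter fun n => (isClopen_setOf_factorAt i n A).isClosed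
  obtain ⟨K, hKS, ⟨hKc, ⟨m, hm⟩, hKi⟩, hKmin⟩ := exists_minimal_shift_invariant
    (hcl (Fac w)) ⟨w, Set.Subset.rfl⟩ fun v hv => (Fac_shift_subset v 1).trans hv
  refine ⟨m, fun u hu => ?_, hKS hm⟩
  by_contra! hN
  have hshift : ∀ i, (fun j => m (j + i)) ∈ K := by
    intro i
    induction i with
    | zero => exact hm
    | succ i ih =>
      have := hKi _ ih
      simpa only [add_assoc, add_comm 1 i] using this
  -- The sets of points of `K` whose prefix of length `N` avoids `u` decrease with `N`; each
  -- contains a shift of `m`.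
  obtain ⟨y, hy⟩ := IsCompact.nonempty_iInter_of_sequence_nonempty_isCompact_isClosed
    (fun N => K ∩ {y : ℕ → α | factorAt y 0 N ∈ {v | ¬ u <:+: v}})
    (fun N y hy => ⟨hy.1, fun h => hy.2 (h.trans (by
      rw [factorAt_succ]; exact (List.prefix_append _ _).isInfix))⟩)
    (fun N => by
      obtain ⟨v, hv, hlen, huv⟩ := hN N
      obtain ⟨i, rfl⟩ := exists_factorAt_eq hv hlen
      exact ⟨_, hshift i, by simpa [factorAt_shift] using huv⟩)
    (hKc.isCompact.inter_right (isClopen_setOf_factorAt _ _ _).isClosed)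
    (fun N => hKc.inter (isClopen_setOf_factorAt _ _ _).isClosed)
  rw [Set.mem_iInter] at hy
  have hyu : u ∉ Fac y := by
    rintro ⟨i, hi⟩
    apply (hy (i + u.length)).2
    rw [factorAt_add, zero_add, hi]
    exact (List.suffix_append _ _).isInfix
  have hsub := hKmin (y := K ∩ {v | Fac v ⊆ {x | x ≠ u}})
    ⟨hKc.inter (hcl _), ⟨y, (hy 0).1, fun x hx hxu => hyu (hxu ▸ hx)⟩,
      fun v hv => ⟨hKi v hv.1, (Fac_shift_subset v 1).trans hv.2⟩⟩ Set.inter_subset_left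
  exact (hsub hm).2 hu rfl

/-- A uniformly recurrent word is either contained in another word, or shares no long factor. -/
theorem UniformlyRecurrent.eventually_subset_or_disjoint {m : ℕ → α} (hm : UniformlyRecurrent m)
    (v : ℕ → α) : ∀ᶠ n in Filter.atTop, Fac m ⊆ Fac v ∨
      ∀ u, u.length = n → u ∈ Fac m → u ∉ Fac v := by
  by_cases h : Fac m ⊆ Fac v
  · exact Filter.Eventually.of_forall fun _ => Or.inl h
  -- Every long enough factor of `m` contains `x`, which `v` lacks.
  · obtain ⟨x, hx, hxv⟩ := Set.not_subset.1 h
    obtain ⟨N, hN⟩ := hm.exists_forall_infix hx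
    filter_upwards [Filter.eventually_ge_atTop N] with n hn
    exact Or.inr fun u hu hum huv => hxv (mem_Fac_of_infix (hN u hum (hu ▸ hn)) huv)

theorem subset_of_level {v v' : ℕ → α} {k n : ℕ} (hkn : k ≤ n)
    (h : ∀ u, u.length = n → u ∈ Fac v → u ∈ Fac v') {u : List α} (hu : u.length = k)
    (huv : u ∈ Fac v) : u ∈ Fac v' := by
  obtain ⟨i, rfl⟩ := exists_factorAt_eq huv hu
  obtain ⟨t, rfl⟩ := Nat.exists_eq_add_of_le hkn
  refine mem_Fac_of_infix ?_ (h (factorAt v i (k + t)) (by simp) (factorAt_mem_Fac _ _ _))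
  rw [factorAt_add]
  exact (List.prefix_append _ _).isInfix

theorem eventually_subset_of_level (v v' : ℕ → α) : ∀ᶠ n in Filter.atTop,
    (∀ u, u.length = n → u ∈ Fac v → u ∈ Fac v') → Fac v ⊆ Fac v' := by
  by_cases h : Fac v ⊆ Fac v'
  · exact Filter.Eventually.of_forall fun _ _ => h
  · obtain ⟨x, hx, hxv⟩ := Set.not_subset.1 h
    filter_upwards [Filter.eventually_ge_atTop x.length] with n hn hsub
    exact (hxv (subset_of_level hn hsub rfl hx)).elim

/-! ### Right extensions at a fixed length -/

section Level

variable [Finite α]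

theorem finite_factors_of_length (w : ℕ → α) (n : ℕ) : {u | u ∈ Fac w ∧ u.length = n}.Finite :=
  (List.finite_length_eq α n).subset fun _ hu => hu.2

/-- The finite set of factors of `w` of length `n`. -/
noncomputable def level (w : ℕ → α) (n : ℕ) : Finset (List α) :=
  (finite_factors_of_length w n).toFinset

theorem mem_level {w : ℕ → α} {n : ℕ} {u : List α} :
    u ∈ level w n ↔ u ∈ Fac w ∧ u.length = n := by
  simp [level]

theorem card_level (w : ℕ → α) (n : ℕ) : (level w n).card = complexity w n := by
  rw [complexity, level, Set.ncard_eq_toFinset_card _ (finite_factors_of_length w n)]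

theorem factorAt_mem_level (w : ℕ → α) (i n : ℕ) : factorAt w i n ∈ level w n :=
  mem_level.2 ⟨factorAt_mem_Fac w i n, length_factorAt w i n⟩

theorem dropLast_mem_level {w : ℕ → α} {n : ℕ} {x : List α} (hx : x ∈ level w (n + 1)) :
    x.dropLast ∈ level w n := by
  rw [mem_level] at *
  exact ⟨dropLast_mem_Fac hx.1, by simp [hx.2]⟩

open scoped Classical in
/-- The one-letter right extensions of `u` among the factors of `w` of length `n + 1`. -/
noncomputable def extensions (w : ℕ → α) (n : ℕ) (u : List α) : Finset (List α) :=
  (level w (n + 1)).filter fun x => x.dropLast = u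

theorem mem_extensions {w : ℕ → α} {n : ℕ} {u x : List α} :
    x ∈ extensions w n u ↔ x ∈ level w (n + 1) ∧ x.dropLast = u := by
  simp [extensions]

theorem card_extensions_pos {w : ℕ → α} {n : ℕ} {u : List α} (hu : u ∈ level w n) :
    1 ≤ (extensions w n u).card := by
  rw [mem_level] at hu
  obtain ⟨x, hx, hlen, hd⟩ := exists_extension hu.1 hu.2
  exact Finset.card_pos.2 ⟨x, mem_extensions.2 ⟨mem_level.2 ⟨hx, hlen⟩, hd⟩⟩

theorem sum_card_extensions_sub_one (w : ℕ → α) (n : ℕ) :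
    ∑ u ∈ level w n, ((extensions w n u).card - 1) + complexity w n = complexity w (n + 1) := by
  classical
  rw [← card_level, ← card_level, Finset.card_eq_sum_ones, ← Finset.sum_add_distrib,
    Finset.card_eq_sum_card_fiberwise (f := List.dropLast) (t := level w n)
      (fun x hx => dropLast_mem_level hx)]
  refine Finset.sum_congr rfl fun u hu => ?_
  rw [Nat.sub_add_cancel (card_extensions_pos hu)]
  rfl

theorem eq_of_dropLast_eq {w : ℕ → α} {n : ℕ} {x y : List α} (hx : x ∈ level w (n + 1))
    (hy : y ∈ level w (n + 1)) (hxy : y.dropLast = x.dropLast)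
    (h : (extensions w n x.dropLast).card ≤ 1) : x = y :=
  Finset.card_le_one.1 h x (mem_extensions.2 ⟨hx, rfl⟩) y (mem_extensions.2 ⟨hy, hxy⟩)

theorem mem_level_of_subset {v w : ℕ → α} (h : Fac v ⊆ Fac w) {n : ℕ} {u : List α}
    (hu : u ∈ level v n) : u ∈ level w n :=
  mem_level.2 ⟨h (mem_level.1 hu).1, (mem_level.1 hu).2⟩

/-- If no factor of `m` of length `n` is right special in `w`, then `w` never leaves `m`. -/
theorem factorAt_mem_of_no_special {w m : ℕ → α} {n : ℕ} (hm : Fac m ⊆ Fac w)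
    (hs : ∀ u ∈ level m n, (extensions w n u).card ≤ 1) {i : ℕ} (hi : factorAt w i n ∈ Fac m)
    {j : ℕ} (hij : i ≤ j) : factorAt w j n ∈ Fac m := by
  induction j, hij using Nat.le_induction with
  | base => exact hi
  | succ j _ ih =>
    obtain ⟨y, hy, hlen, hd⟩ := exists_extension ih (length_factorAt w j n)
    -- The current vertex has only one outgoing edge, and `m` already uses one.
    have hx : factorAt w j (n + 1) = y :=
      eq_of_dropLast_eq (factorAt_mem_level w j (n + 1)) (mem_level.2 ⟨hm hy, hlen⟩)
        (by simpa using hd) (by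
          rw [dropLast_factorAt]
          exact hs _ (mem_level.2 ⟨ih, length_factorAt w j n⟩))
    exact factorAt_succ_mem_of_edge (hx ▸ hy)

end Level

/-! ### Counting in the Rauzy graph -/

section Counting

variable [Finite α] {ι : Type*} (w : ℕ → α) (n : ℕ) (v : ι → ℕ → α) (U : Finset ι)

open scoped Classical in
/-- The factors of length `n` of the words indexed by `U`. -/
noncomputable def core : Finset (List α) :=
  (level w n).filter fun u => ∃ m ∈ U, u ∈ Fac (v m)

open scoped Classical in
/-- The factors of length `n + 1` that leave the words indexed by `U`. -/
noncomputable def exits : Finset (List α) :=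
  (level w (n + 1)).filter fun x => x.dropLast ∈ core w n v U ∧ ∀ m ∈ U, x ∉ Fac (v m)

open scoped Classical in
/-- The extensions of the right special factors of length `n` outside the core. -/
noncomputable def branches : Finset (List α) :=
  (level w (n + 1)).filter fun x =>
    x.dropLast ∉ core w n v U ∧ 2 ≤ (extensions w n x.dropLast).card

/-- The number of surplus extensions of the core. -/
noncomputable def coreExcess : ℕ := ∑ u ∈ core w n v U, ((extensions w n u).card - 1)

variable {w n v U}

theorem mem_core {u : List α} :
    u ∈ core w n v U ↔ u ∈ level w n ∧ ∃ m ∈ U, u ∈ Fac (v m) := by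
  simp [core]

theorem mem_exits {x : List α} : x ∈ exits w n v U ↔
    x ∈ level w (n + 1) ∧ x.dropLast ∈ core w n v U ∧ ∀ m ∈ U, x ∉ Fac (v m) := by
  simp [exits]

theorem mem_branches {x : List α} : x ∈ branches w n v U ↔
    x ∈ level w (n + 1) ∧ x.dropLast ∉ core w n v U ∧
      2 ≤ (extensions w n x.dropLast).card := by
  simp [branches]

variable (w n v U) in
-- Here `r` is the surplus outside the core; a vertex with `t ≥ 2` extensions contributes `t ≤ 2(t -
-- 1)` branches.
theorem coreExcess_add : ∃ r, coreExcess w n v U + r + complexity w n = complexity w (n + 1) ∧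
    (branches w n v U).card ≤ 2 * r := by
  classical
  have hsub : core w n v U ⊆ level w n := Finset.filter_subset _ _
  refine ⟨∑ u ∈ level w n \ core w n v U, ((extensions w n u).card - 1), ?_, ?_⟩
  · rw [← sum_card_extensions_sub_one, coreExcess, add_comm (∑ u ∈ core w n v U, _),
      Finset.sum_sdiff hsub]
  · rw [Finset.card_eq_sum_card_fiberwise (f := List.dropLast)
      (t := level w n \ core w n v U) (fun x hx => by
        have := mem_branches.1 hx
        simpa using ⟨dropLast_mem_level this.1, this.2.1⟩), Finset.mul_sum]
    refine Finset.sum_le_sum fun u hu => ?_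
    rcases Finset.eq_empty_or_nonempty ((branches w n v U).filter fun x => x.dropLast = u) with
      h | ⟨x, hx⟩
    · simp [h]
    · rw [Finset.mem_filter, mem_branches] at hx
      have h2 : 2 ≤ (extensions w n u).card := hx.2 ▸ hx.1.2.2
      have : ((branches w n v U).filter fun x => x.dropLast = u).card ≤
          (extensions w n u).card := by
        refine Finset.card_le_card fun y hy => ?_
        rw [Finset.mem_filter, mem_branches] at hy
        exact mem_extensions.2 ⟨hy.1.1, hy.2⟩
      omega

/-- At each core vertex at least one extension stays inside a word indexed by `U`, so the exits
there number at most the surplus. -/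
theorem card_exits_le (hsub : ∀ m ∈ U, Fac (v m) ⊆ Fac w) :
    (exits w n v U).card ≤ coreExcess w n v U := by
  classical
  rw [Finset.card_eq_sum_card_fiberwise (f := List.dropLast)
    (t := core w n v U) (fun x hx => (mem_exits.1 hx).2.1), coreExcess]
  refine Finset.sum_le_sum fun u hu => ?_
  rw [mem_core, mem_level] at hu
  obtain ⟨⟨hu, hn⟩, m, hm, hum⟩ := hu
  obtain ⟨x, hx, hlen, hd⟩ := exists_extension hum hn
  refine Nat.le_sub_one_of_lt (Finset.card_lt_card (Finset.ssubset_iff_subset_ne.2 ⟨?_, ?_⟩))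
  · intro y hy
    rw [Finset.mem_filter, mem_exits] at hy
    exact mem_extensions.2 ⟨hy.1.1, hy.2⟩
  · intro h
    have : x ∈ extensions w n u := mem_extensions.2 ⟨mem_level.2 ⟨hsub m hm hx, hlen⟩, hd⟩
    rw [← h, Finset.mem_filter, mem_exits] at this
    exact this.1.2.2 m hm hx

/-- Words having a right special factor contribute distinct vertices with positive surplus. Two
words without one would both trap `w` eventually, contradicting disjointness. -/
theorem card_le_coreExcess_add_one (hsub : ∀ m ∈ U, Fac (v m) ⊆ Fac w)
    (hdisj : ∀ m ∈ U, ∀ m' ∈ U, ∀ u, u.length = n → u ∈ Fac (v m) → u ∈ Fac (v m') → m = m') :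
    U.card ≤ coreExcess w n v U + 1 := by
  classical
  set P : ι → Prop := fun m => ∃ u ∈ level (v m) n, 2 ≤ (extensions w n u).card
  rw [← Finset.card_filter_add_card_filter_not (s := U) P]
  refine add_le_add ?_ ?_
  · choose! f hf hf2 using fun m (hm : P m) => hm
    calc (U.filter P).card
        ≤ ((core w n v U).filter fun u => 2 ≤ (extensions w n u).card).card := by
          refine Finset.card_le_card_of_injOn f (fun m hm => ?_) (fun m hm m' hm' h => ?_)
          · rw [Finset.mem_coe, Finset.mem_filter] at hm
            rw [Finset.mem_coe, Finset.mem_filter, mem_core]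
            exact ⟨⟨mem_level_of_subset (hsub m hm.1) (hf m hm.2), m, hm.1,
              (mem_level.1 (hf m hm.2)).1⟩, hf2 m hm.2⟩
          · rw [Finset.mem_coe, Finset.mem_filter] at hm hm'
            have h1 := mem_level.1 (hf m hm.2)
            have h2 := mem_level.1 (hf m' hm'.2)
            exact hdisj m hm.1 m' hm'.1 _ h1.2 h1.1 (h ▸ h2.1)
      _ ≤ coreExcess w n v U := by
          rw [Finset.card_filter, coreExcess]
          refine Finset.sum_le_sum fun u _ => ?_
          split_ifs <;> omega
  · rw [Finset.card_le_one]
    intro m hm m' hm'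
    rw [Finset.mem_filter] at hm hm'
    have hev : ∀ m, m ∈ U ∧ ¬ P m → ∃ i, ∀ j ≥ i, factorAt w j n ∈ Fac (v m) := by
      rintro m ⟨hmU, hmP⟩
      obtain ⟨i, hi⟩ := exists_factorAt_eq (hsub m hmU (factorAt_mem_Fac (v m) 0 n))
        (length_factorAt _ _ _)
      refine ⟨i, fun j hj => factorAt_mem_of_no_special (hsub m hmU) (fun u hu => ?_)
        (hi ▸ factorAt_mem_Fac (v m) 0 n) hj⟩
      by_contra! h
      exact hmP ⟨u, hu, h⟩
    obtain ⟨i, hi⟩ := hev m hm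
    obtain ⟨j, hj⟩ := hev m' hm'
    exact hdisj m hm.1 m' hm'.1 _ (length_factorAt w (max i j) n) (hi _ (le_max_left _ _))
      (hj _ (le_max_right _ _))

open scoped Classical in
/-- A recurrent word that meets `y` at level `n` and shares its exits and branches with `y` has
all its factors of length `n` in common with `y`. -/
theorem level_subset_of_shared_edges {x y : ℕ → α} (hx : Recurrent x) (hxw : Fac x ⊆ Fac w)
    (hyw : Fac y ⊆ Fac w)
    (hU : ∀ m ∈ U, Fac (v m) ⊆ Fac y ∨ ∀ u, u.length = n → u ∈ Fac (v m) → u ∉ Fac y)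
    (hedge : ∀ z ∈ exits w n v U ∪ branches w n v U, z ∈ Fac x → z ∈ Fac y)
    {u₀ : List α} (hlen : u₀.length = n) (hux : u₀ ∈ Fac x) (huy : u₀ ∈ Fac y)
    {u : List α} (hu : u.length = n) (hu' : u ∈ Fac x) : u ∈ Fac y := by
  classical
  obtain ⟨i, rfl⟩ := exists_factorAt_eq hux hlen
  obtain ⟨j, hij, rfl⟩ := hx.exists_ge hu' hu i
  clear hu hu'
  -- Follow `x` from the common vertex: each edge is shared by hypothesis, lies in some `v m` that
  -- meets `y` and hence is contained in it, or is the only extension available to `y`.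
  induction j, hij using Nat.le_induction with
  | base => exact huy
  | succ j _ ih =>
    refine factorAt_succ_mem_of_edge ?_
    have hzx := factorAt_mem_Fac x j (n + 1)
    have hzw : factorAt x j (n + 1) ∈ level w (n + 1) := mem_level.2 ⟨hxw hzx, by simp⟩
    by_cases hE : factorAt x j (n + 1) ∈ exits w n v U ∪ branches w n v U
    · exact hedge _ hE hzx
    rw [Finset.mem_union, not_or, mem_exits, mem_branches] at hE
    by_cases hD : factorAt x j n ∈ core w n v U
    · have : ∃ m ∈ U, factorAt x j (n + 1) ∈ Fac (v m) := by
        by_contra! h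
        exact hE.1 ⟨hzw, by simpa using hD, h⟩
      obtain ⟨m, hm, hzm⟩ := this
      rcases hU m hm with h | h
      · exact h hzm
      · exact (h _ (length_factorAt x j n) (by simpa using dropLast_mem_Fac hzm) ih).elim
    · have hdeg : (extensions w n (factorAt x j n)).card ≤ 1 := by
        by_contra! h
        exact hE.2 ⟨hzw, by simpa using hD, by rwa [dropLast_factorAt]⟩
      obtain ⟨z, hz, hzl, hzd⟩ := exists_extension ih (length_factorAt x j n)
      have : factorAt x j (n + 1) = z := eq_of_dropLast_eq hzw (mem_level.2 ⟨hyw hz, hzl⟩)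
        (by simpa using hzd) (by simpa using hdeg)
      exact this ▸ hz

/-- A recurrent word properly containing a word indexed by `U` has an exit as a factor. -/
theorem exists_exit_mem {x : ℕ → α} (hx : Recurrent x) (hxw : Fac x ⊆ Fac w)
    (hdisj : ∀ m ∈ U, ∀ m' ∈ U, ∀ u, u.length = n → u ∈ Fac (v m) → u ∈ Fac (v m') → m = m')
    {m : ι} (hm : m ∈ U) (hmx : Fac (v m) ⊆ Fac x)
    {u : List α} (hu : u.length = n) (hux : u ∈ Fac x) (hum : u ∉ Fac (v m)) :
    ∃ z ∈ exits w n v U, z ∈ Fac x := by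
  by_contra! h
  obtain ⟨i, hi⟩ := exists_factorAt_eq (hmx (factorAt_mem_Fac (v m) 0 n)) (length_factorAt _ _ _)
  obtain ⟨j, hij, rfl⟩ := hx.exists_ge hux hu i
  clear hu hux
  refine hum ?_
  clear hum
  induction j, hij using Nat.le_induction with
  | base => exact hi ▸ factorAt_mem_Fac (v m) 0 n
  | succ j _ ih =>
    have hzx := factorAt_mem_Fac x j (n + 1)
    have hex : ∃ m' ∈ U, factorAt x j (n + 1) ∈ Fac (v m') := by
      by_contra! hcon
      refine h _ (mem_exits.2 ⟨mem_level.2 ⟨hxw hzx, by simp⟩, ?_, hcon⟩) hzx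
      rw [dropLast_factorAt, mem_core, mem_level]
      exact ⟨⟨hxw (factorAt_mem_Fac x j n), by simp⟩, m, hm, ih⟩
    obtain ⟨m', hm', hz⟩ := hex
    -- An edge that is no exit lies in some `v m'`, and disjointness forbids switching from `m` to
    -- another word.
    have : m = m' := hdisj m hm m' hm' _ (length_factorAt x j n) ih
      (by simpa using dropLast_mem_Fac hz)
    exact factorAt_succ_mem_of_edge (this ▸ hz)

theorem card_filter_inter_nonempty {β : Type*} [DecidableEq β] (A B : Finset β)
    (hAB : Disjoint A B) :
    ((A ∪ B).powerset.filter fun R => (R ∩ A).Nonempty).card + 2 ^ B.card =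
      2 ^ A.card * 2 ^ B.card := by
  rw [← pow_add, ← Finset.card_union_of_disjoint hAB, ← Finset.card_powerset (A ∪ B),
    ← Finset.card_powerset B, ← Finset.card_filter_add_card_filter_not (s := (A ∪ B).powerset)
      fun R => (R ∩ A).Nonempty]
  congr 2
  ext R
  simp only [Finset.mem_powerset, Finset.mem_filter, Finset.not_nonempty_iff_eq_empty,
    ← Finset.disjoint_iff_inter_eq_empty]
  refine ⟨fun h => ⟨h.trans Finset.subset_union_right, (hAB.mono_right h).symm⟩, fun h => ?_⟩
  exact h.2.left_le_of_le_sup_left h.1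

/-- Each word is encoded by the exits and branches it uses. The encoding is injective because the
set contains an exit, whose prefix of length `n` is a vertex shared by any two words with the same
code. -/
theorem card_nonminimal_le {F : Finset ι} [DecidableEq ι] (hUF : U ⊆ F)
    (hrec : ∀ i ∈ F, Recurrent (v i)) (hsub : ∀ i ∈ F, Fac (v i) ⊆ Fac w)
    (hdist : ∀ i ∈ F, ∀ j ∈ F,
      (∀ u, u.length = n → (u ∈ Fac (v i) ↔ u ∈ Fac (v j))) → i = j)
    (hdich : ∀ m ∈ U, ∀ i ∈ F, Fac (v m) ⊆ Fac (v i) ∨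
      ∀ u, u.length = n → u ∈ Fac (v m) → u ∉ Fac (v i))
    (hdisj : ∀ m ∈ U, ∀ m' ∈ U, ∀ u, u.length = n → u ∈ Fac (v m) → u ∈ Fac (v m') → m = m')
    (hbelow : ∀ i ∈ F, ∃ m ∈ U, Fac (v m) ⊆ Fac (v i)) :
    (F \ U).card + 2 ^ (branches w n v U).card ≤
      2 ^ (exits w n v U).card * 2 ^ (branches w n v U).card := by
  classical
  have hAB : Disjoint (exits w n v U) (branches w n v U) :=
    Finset.disjoint_left.2 fun x h1 h2 => (mem_branches.1 h2).2.1 (mem_exits.1 h1).2.1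
  rw [← card_filter_inter_nonempty _ _ hAB]
  refine Nat.add_le_add_right ?_ _
  have hexit : ∀ i ∈ F \ U, ∃ z ∈ exits w n v U, z ∈ Fac (v i) := by
    intro i hi
    rw [Finset.mem_sdiff] at hi
    obtain ⟨m, hm, hmi⟩ := hbelow i hi.1
    have : ∃ u, u.length = n ∧ u ∈ Fac (v i) ∧ u ∉ Fac (v m) := by
      by_contra! h
      have := hdist i hi.1 m (hUF hm) fun u hu => ⟨h u hu, fun hum => hmi hum⟩
      exact hi.2 (this ▸ hm)
    obtain ⟨u, hu, hui, hum⟩ := this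
    exact exists_exit_mem (hrec i hi.1) (hsub i hi.1) hdisj hm hmi hu hui hum
  refine Finset.card_le_card_of_injOn
    (fun i => (exits w n v U ∪ branches w n v U).filter fun z => z ∈ Fac (v i)) ?_ ?_
  · intro i hi
    obtain ⟨z, hz, hzi⟩ := hexit i hi
    rw [Finset.mem_coe, Finset.mem_filter]
    exact ⟨Finset.mem_powerset.2 (Finset.filter_subset _ _),
      z, by simp [hz, hzi]⟩
  · intro i hi j hj hij
    obtain ⟨z, hz, hzi⟩ := hexit i hi
    have hiF := (Finset.mem_sdiff.1 hi).1
    have hjF := (Finset.mem_sdiff.1 hj).1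
    have hedge : ∀ z ∈ exits w n v U ∪ branches w n v U, z ∈ Fac (v i) ↔ z ∈ Fac (v j) := by
      intro z hz
      have := Finset.ext_iff.1 hij z
      simpa [Finset.mem_filter, hz] using this
    have hzj := (hedge z (Finset.mem_union_left _ hz)).1 hzi
    have hlen : z.dropLast.length = n := by
      simp [(mem_level.1 (mem_exits.1 hz).1).2]
    refine hdist i hiF j hjF fun u hu => ⟨fun h => ?_, fun h => ?_⟩
    · exact level_subset_of_shared_edges (hrec i hiF) (hsub i hiF) (hsub j hjF)
        (fun m hm => hdich m hm j hjF) (fun z hz => (hedge z hz).1) hlen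
        (dropLast_mem_Fac hzi) (dropLast_mem_Fac hzj) hu h
    · exact level_subset_of_shared_edges (hrec j hjF) (hsub j hjF) (hsub i hiF)
        (fun m hm => hdich m hm i hiF) (fun z hz => (hedge z hz).2) hlen
        (dropLast_mem_Fac hzj) (dropLast_mem_Fac hzi) hu h

end Counting

/-! ### Arithmetic, asymptotics and representatives -/

/-- For `e = 0` the hypotheses force `k = 0` and `u ≤ 1`. Otherwise `k + u ≤ 2 + 4^(d-1)`, which is
compared with `d + d!^2`; for `d = 1` that comparison fails, and `hc1` supplies `c ≥ 2`. -/
theorem add_le_factorial_sq {c d e r k u : ℕ} (hdc : d ≤ c) (hc : 1 ≤ c) (hc1 : c = 1 → d = 0)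
    (her : e + r = d) (hu : u ≤ e + 1) (hk : k + 4 ^ r ≤ 2 ^ e * 4 ^ r) :
    k + u ≤ d + c.factorial ^ 2 := by
  have hfac : 1 ≤ c.factorial ^ 2 := Nat.one_le_pow _ _ c.factorial_pos
  obtain _ | e := e
  · simp at hk; omega
  have hbig : ∀ d, 2 ≤ d → 2 + 4 ^ (d - 1) ≤ d + d.factorial ^ 2 := by
    intro d hd
    induction d, hd using Nat.le_induction with
    | base => decide
    | succ d hd ih =>
      obtain ⟨t, rfl⟩ := Nat.exists_eq_add_of_le' hd
      simp only [Nat.add_sub_cancel] at ih ⊢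
      rw [Nat.factorial_succ, mul_pow]
      have h1 : 4 ^ (t + 2) = 4 * 4 ^ (t + 2 - 1) := by
        rw [← pow_succ']; rfl
      have h2 := Nat.self_le_factorial (t + 2)
      have h3 : 9 * (t + 2).factorial ^ 2 ≤ (t + 2 + 1) ^ 2 * (t + 2).factorial ^ 2 :=
        Nat.mul_le_mul_right _ (by nlinarith)
      have h4 : t + 2 ≤ (t + 2).factorial ^ 2 := by nlinarith
      omega
  have hd : 2 + 4 ^ (d - 1) ≤ d + c.factorial ^ 2 := by
    rcases Nat.lt_or_ge d 2 with h | h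
    · obtain rfl : d = 1 := by omega
      have : 2 ≤ c := by by_contra; have := hc1 (by omega); omega
      have : 2 ≤ c.factorial := this.trans (Nat.self_le_factorial c)
      simp only [Nat.sub_self, pow_zero]
      nlinarith
    · have := hbig d h
      have : d.factorial ^ 2 ≤ c.factorial ^ 2 := Nat.pow_le_pow_left (Nat.factorial_le hdc) 2
      omega
  have hpow : (4 : ℕ) ^ (d - 1) = (2 ^ e) ^ 2 * 4 ^ r := by
    have : d - 1 = e + r := by omega
    rw [this, pow_add, ← pow_mul, mul_comm e 2, pow_mul]
    norm_num
  obtain ⟨x, hx⟩ := Nat.exists_eq_add_of_lt (Nat.lt_two_pow_self (n := e))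
  have hr : 1 ≤ 4 ^ r := Nat.one_le_pow _ _ (by norm_num)
  -- After the case split `e` stands for the old `e` minus one; the claim amounts to `e ≤ (2^e -
  -- 1)^2 * 4^r`.
  have key : 2 ^ (e + 1) * 4 ^ r + e ≤ (2 ^ e) ^ 2 * 4 ^ r + 4 ^ r := by
    have h1 : e ≤ (e + x) ^ 2 := by nlinarith [Nat.le_self_pow (n := 2) (by norm_num) e]
    have h2 : e ≤ (e + x) ^ 2 * 4 ^ r := h1.trans (Nat.le_mul_of_pos_right _ hr)
    rw [pow_succ, hx]
    linarith [h2, (by ring : (e + x + 1) ^ 2 * 4 ^ r + 4 ^ r =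
      (e + x + 1) * 2 * 4 ^ r + (e + x) ^ 2 * 4 ^ r)]
  omega

theorem finite_and_ncard_le {β : Type*} {S : Set β} {N : ℕ}
    (h : ∀ F : Finset β, (F : Set β) ⊆ S → F.card ≤ N) : S.Finite ∧ S.ncard ≤ N := by
  have hfin : S.Finite := by
    by_contra hinf
    obtain ⟨F, hF, hc⟩ := Set.Infinite.exists_subset_card_eq hinf (N + 1)
    have := h F hF
    omega
  refine ⟨hfin, ?_⟩
  rw [Set.ncard_eq_toFinset_card S hfin]
  exact h _ (by simp)

theorem natCast_le_limsupDiff {w : ℕ → α} {d : ℕ}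
    (hd : ∀ᶠ n in Filter.atTop, complexity w n + d ≤ complexity w (n + 1)) :
    (d : EReal) ≤ limsupDiff w := by
  refine Filter.le_limsup_of_frequently_le (hd.mono fun n hn => ?_).frequently
  have : (d : ℝ) ≤ complexity w (n + 1) - complexity w n := by
    rw [le_sub_iff_add_le']
    exact_mod_cast hn
  exact_mod_cast EReal.coe_le_coe_iff.2 this

theorem eventually_eq_of_level_eq {ι : Type*} {v : ι → ℕ → α} {F : Finset ι}
    (hinj : ∀ i ∈ F, ∀ j ∈ F, Fac (v i) = Fac (v j) → i = j) :
    ∀ᶠ n in Filter.atTop, ∀ i ∈ F, ∀ j ∈ F,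
      (∀ u, u.length = n → (u ∈ Fac (v i) ↔ u ∈ Fac (v j))) → i = j := by
  refine (Filter.eventually_all_finset _).2 fun i hi => (Filter.eventually_all_finset _).2
    fun j hj => ?_
  filter_upwards [eventually_subset_of_level (v i) (v j), eventually_subset_of_level (v j) (v i)]
    with n h1 h2 h
  exact hinj i hi j hj
    ((h1 fun u hu => (h u hu).1).antisymm (h2 fun u hu => (h u hu).2))

theorem eventually_subset_or_disjoint {ι : Type*} {v : ι → ℕ → α} {F U : Finset ι} (hU : ∀ m ∈ U, UniformlyRecurrent (v m)) :
    ∀ᶠ n in Filter.atTop, ∀ m ∈ U, ∀ i ∈ F, Fac (v m) ⊆ Fac (v i) ∨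
      ∀ u, u.length = n → u ∈ Fac (v m) → u ∉ Fac (v i) :=
  (Filter.eventually_all_finset _).2 fun m hm => (Filter.eventually_all_finset _).2
    fun i _ => (hU m hm).eventually_subset_or_disjoint (v i)

theorem eventually_disjoint {ι : Type*} {v : ι → ℕ → α} {U : Finset ι} (hU : ∀ m ∈ U, UniformlyRecurrent (v m))
    (hinj : ∀ i ∈ U, ∀ j ∈ U, Fac (v i) = Fac (v j) → i = j) :
    ∀ᶠ n in Filter.atTop, ∀ m ∈ U, ∀ m' ∈ U, ∀ u, u.length = n →
      u ∈ Fac (v m) → u ∈ Fac (v m') → m = m' := by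
  filter_upwards [eventually_subset_or_disjoint (F := U) hU] with n h m hm m' hm' u hu h1 h2
  refine hinj m hm m' hm' (Set.Subset.antisymm ?_ ?_)
  · exact (h m hm m' hm').resolve_right fun h => h u hu h1 h2
  · exact (h m' hm' m hm).resolve_right fun h => h u hu h2 h1

theorem exists_representative_recurrent (w : ℕ → α) :
    ∃ v : WordClass α → ℕ → α, ∀ c ∈ RecSpec w, Recurrent (v c) ∧ Fac (v c) ⊆ Fac w ∧
      c = cls (v c) ∧ (c ∈ URecSpec w → UniformlyRecurrent (v c)) := by
  have : ∀ c, ∃ x : ℕ → α, c ∈ RecSpec w → Recurrent x ∧ Fac x ⊆ Fac w ∧ c = cls x ∧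
      (c ∈ URecSpec w → UniformlyRecurrent x) := by
    intro c
    by_cases hU : c ∈ URecSpec w
    · obtain ⟨x, hx, hle, rfl⟩ := hU
      exact ⟨x, fun _ => ⟨hx.recurrent, hle, rfl, fun _ => hx⟩⟩
    · by_cases hR : c ∈ RecSpec w
      · obtain ⟨x, hx, hle, rfl⟩ := hR
        exact ⟨x, fun _ => ⟨hx, hle, rfl, fun h => (hU h).elim⟩⟩
      · exact ⟨w, fun h => (hR h).elim⟩
  choose v hv using this
  exact ⟨v, hv⟩

theorem URecSpec_subset_RecSpec (w : ℕ → α) : URecSpec w ⊆ RecSpec w :=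
  fun _ ⟨x, hx, hle, h⟩ => ⟨x, hx.recurrent, hle, h⟩

variable [Finite α]

theorem complexity_le_succ (w : ℕ → α) (n : ℕ) : complexity w n ≤ complexity w (n + 1) := by
  rw [← sum_card_extensions_sub_one w n]
  exact Nat.le_add_left _ _

theorem complexity_pos (w : ℕ → α) (n : ℕ) : 1 ≤ complexity w n := by
  rw [← card_level]
  exact Finset.card_pos.2 ⟨_, factorAt_mem_level w 0 n⟩

theorem complexity_le_one (w : ℕ → α) (h : complexity w 1 ≤ 1) (n : ℕ) : complexity w n ≤ 1 := by
  rw [← card_level] at h ⊢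
  have hw : ∀ i j, w i = w j := by
    intro i j
    have := Finset.card_le_one.1 h _ (factorAt_mem_level w i 1) _ (factorAt_mem_level w j 1)
    simpa [factorAt] using this
  refine Finset.card_le_one.2 fun x hx y hy => ?_
  rw [mem_level] at hx hy
  obtain ⟨i, rfl⟩ := exists_factorAt_eq hx.1 hx.2
  obtain ⟨j, rfl⟩ := exists_factorAt_eq hy.1 hy.2
  simp only [factorAt]
  congr 1
  ext k
  exact hw _ _

/-- The lower limit of the first differences of the complexity is a natural number `≤ C`. -/
theorem exists_liminf_diff {w : ℕ → α} {C : ℝ}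
    (hC : ∀ n : ℕ, 1 ≤ n → (complexity w n : ℝ) ≤ C * n) :
    ∃ d : ℕ, (d : ℝ) ≤ C ∧ (∀ᶠ n in Filter.atTop, complexity w n + d ≤ complexity w (n + 1)) ∧
      ∃ᶠ n in Filter.atTop, complexity w (n + 1) = complexity w n + d := by
  classical
  have hbound : ∀ d : ℕ, (∀ᶠ n in Filter.atTop, complexity w n + d ≤ complexity w (n + 1)) →
      (d : ℝ) ≤ C := by
    intro d hd
    obtain ⟨N, hN⟩ := Filter.eventually_atTop.1 hd
    by_contra! hlt
    have hlin : ∀ k, k * d ≤ complexity w (N + k) := by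
      intro k
      induction k with
      | zero => simp
      | succ k ih =>
        have := hN (N + k) (by omega)
        rw [← add_assoc, add_one_mul]
        omega
    obtain ⟨k, hk⟩ := exists_nat_gt (C * N / (d - C))
    rw [div_lt_iff₀ (by linarith)] at hk
    have h1 := hC (N + (k + 1)) (by omega)
    have h2 : (((k + 1) * d : ℕ) : ℝ) ≤ complexity w (N + (k + 1)) := by exact_mod_cast hlin (k + 1)
    push_cast at h1 h2
    nlinarith
  have hex : ∃ d, ¬ ∀ᶠ n in Filter.atTop, complexity w n + d ≤ complexity w (n + 1) := by
    obtain ⟨d, hd⟩ := exists_nat_gt C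
    exact ⟨d, fun h => absurd (hbound d h) (not_le.2 hd)⟩
  -- The least eventual lower bound that fails is `d + 1`: `d` holds eventually while `d + 1` fails
  -- infinitely often, so the difference is exactly `d` infinitely often.
  obtain ⟨d, hd⟩ : ∃ d, Nat.find hex = d + 1 := by
    refine Nat.exists_eq_succ_of_ne_zero fun h => ?_
    have := Nat.find_spec hex
    rw [h] at this
    exact this (Filter.Eventually.of_forall fun n => complexity_le_succ w n)
  have hev : ∀ᶠ n in Filter.atTop, complexity w n + d ≤ complexity w (n + 1) := by
    have := Nat.find_min hex (m := d) (by omega)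
    exact not_not.1 this
  refine ⟨d, hbound d hev, hev, ?_⟩
  have hfreq := Nat.find_spec hex
  rw [hd, Filter.not_eventually] at hfreq
  exact (hfreq.and_eventually hev).mono fun n hn => by omega

/-! ### Bounds for finite families of classes -/

section Eventually

variable {ι : Type*} {v : ι → ℕ → α}

theorem eventually_card_uniformlyRecurrent_le {w : ℕ → α} {U : Finset ι}
    (hU : ∀ m ∈ U, UniformlyRecurrent (v m))
    (hinj : ∀ i ∈ U, ∀ j ∈ U, Fac (v i) = Fac (v j) → i = j)
    (hsub : ∀ i ∈ U, Fac (v i) ⊆ Fac w) :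
    ∀ᶠ n in Filter.atTop, U.card + complexity w n ≤ complexity w (n + 1) + 1 := by
  filter_upwards [eventually_disjoint hU hinj] with n hdisj
  have h1 := card_le_coreExcess_add_one hsub hdisj
  obtain ⟨r, h2, -⟩ := coreExcess_add w n v U
  omega

theorem eventually_card_recurrent_le [DecidableEq ι] {w : ℕ → α} {F U : Finset ι} (hUF : U ⊆ F)
    (hrec : ∀ i ∈ F, Recurrent (v i)) (hU : ∀ m ∈ U, UniformlyRecurrent (v m))
    (hinj : ∀ i ∈ F, ∀ j ∈ F, Fac (v i) = Fac (v j) → i = j)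
    (hsub : ∀ i ∈ F, Fac (v i) ⊆ Fac w)
    (hbelow : ∀ i ∈ F, ∃ m ∈ U, Fac (v m) ⊆ Fac (v i)) :
    ∀ᶠ n in Filter.atTop, ∃ e r, e + r + complexity w n = complexity w (n + 1) ∧
      U.card ≤ e + 1 ∧ (F \ U).card + 4 ^ r ≤ 2 ^ e * 4 ^ r := by
  filter_upwards [eventually_disjoint hU fun i hi j hj => hinj i (hUF hi) j (hUF hj),
    eventually_subset_or_disjoint (F := F) hU, eventually_eq_of_level_eq hinj] with n hdisj hdich hdist
  obtain ⟨r, hr, hB⟩ := coreExcess_add w n v U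
  have hUsub : ∀ m ∈ U, Fac (v m) ⊆ Fac w := fun m hm => hsub m (hUF hm)
  refine ⟨coreExcess w n v U, r, hr, card_le_coreExcess_add_one hUsub hdisj, ?_⟩
  have hA := card_exits_le (n := n) hUsub
  have hcard := card_nonminimal_le (n := n) hUF hrec hsub hdist hdich hdisj hbelow
  have hA' : 2 ^ (exits w n v U).card ≤ 2 ^ coreExcess w n v U :=
    Nat.pow_le_pow_right (by norm_num) hA
  have hB' : 2 ^ (branches w n v U).card ≤ 4 ^ r := by
    calc 2 ^ (branches w n v U).card ≤ 2 ^ (2 * r) := Nat.pow_le_pow_right (by norm_num) hB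
      _ = 4 ^ r := by rw [pow_mul]; norm_num
  -- The bound `(a - 1) * b` is monotone in both `a ≥ 1` and `b`, so the cardinalities may be
  -- replaced by their upper bounds.
  have ha : 1 ≤ 2 ^ (exits w n v U).card := Nat.one_le_two_pow
  generalize 2 ^ (exits w n v U).card = a at *
  generalize 2 ^ (branches w n v U).card = b at *
  generalize 2 ^ coreExcess w n v U = a' at *
  generalize 4 ^ r = b' at *
  obtain ⟨x, rfl⟩ := Nat.exists_eq_add_of_le ha
  obtain ⟨y, rfl⟩ := Nat.exists_eq_add_of_le hA'
  obtain ⟨z, rfl⟩ := Nat.exists_eq_add_of_le hB'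
  nlinarith [Nat.zero_le (x * z), Nat.zero_le (y * b), Nat.zero_le (y * z)]

end Eventually

theorem exists_uRecSpec_below {w : ℕ → α} {x : ℕ → α} (hx : Fac x ⊆ Fac w) :
    ∃ c ∈ URecSpec w, cls x ≤ c := by
  obtain ⟨m, hm, hmx⟩ := exists_uniformlyRecurrent x
  exact ⟨cls m, ⟨m, hm, hmx.trans hx, rfl⟩, hmx⟩

theorem card_le_of_subset_uRecSpec {w : ℕ → α} {d : ℕ}
    (hd : ∃ᶠ n in Filter.atTop, complexity w (n + 1) = complexity w n + d)
    {U : Finset (WordClass α)} (hU : (U : Set (WordClass α)) ⊆ URecSpec w) : U.card ≤ d + 1 := by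
  obtain ⟨v, hv⟩ := exists_representative_recurrent w
  have hR : ∀ c ∈ U, c ∈ RecSpec w := fun c hc => URecSpec_subset_RecSpec w (hU hc)
  obtain ⟨n, h1, h2⟩ := (hd.and_eventually (eventually_card_uniformlyRecurrent_le
    (v := v) (U := U) (w := w) (fun c hc => (hv c (hR c hc)).2.2.2 (hU hc))
    (fun i hi j hj h => by
      rw [(hv i (hR i hi)).2.2.1, (hv j (hR j hj)).2.2.1]
      exact WordClass.fac_injective h)
    (fun c hc => (hv c (hR c hc)).2.1))).exists
  omega

theorem card_le_of_subset_recSpec {w : ℕ → α} {c d : ℕ}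
    (hd : ∃ᶠ n in Filter.atTop, complexity w (n + 1) = complexity w n + d)
    (hdc : d ≤ c) (hc : 1 ≤ c) (hc1 : c = 1 → d = 0)
    {F : Finset (WordClass α)} (hF : (F : Set (WordClass α)) ⊆ RecSpec w) :
    F.card ≤ d + c.factorial ^ 2 := by
  classical
  obtain ⟨v, hv⟩ := exists_representative_recurrent w
  have hmin : ∀ x, ∃ m, x ∈ RecSpec w → m ∈ URecSpec w ∧ x ≤ m := by
    intro x
    by_cases hx : x ∈ RecSpec w
    · obtain ⟨m, hm, hle⟩ := exists_uRecSpec_below (hv x hx).2.1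
      exact ⟨m, fun _ => ⟨hm, (hv x hx).2.2.1 ▸ hle⟩⟩
    · exact ⟨x, fun h => (hx h).elim⟩
  choose μ hμ using hmin
  -- Adjoining a uniformly recurrent class above each member of `F` secures the containment
  -- hypothesis and only enlarges the family.
  set U := F.image μ
  have hUU : ∀ m ∈ U, m ∈ URecSpec w := by
    intro m hm
    obtain ⟨x, hx, rfl⟩ := Finset.mem_image.1 hm
    exact (hμ x (hF hx)).1
  have hR : ∀ x ∈ F ∪ U, x ∈ RecSpec w := by
    intro x hx
    rcases Finset.mem_union.1 hx with h | h
    · exact hF h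
    · exact URecSpec_subset_RecSpec w (hUU x h)
  have hfac : ∀ x ∈ F ∪ U, x.fac = Fac (v x) := fun x hx =>
    congrArg WordClass.fac (hv x (hR x hx)).2.2.1
  obtain ⟨n, h1, e, r, her, hu, hk⟩ := (hd.and_eventually (eventually_card_recurrent_le
    (v := v) (F := F ∪ U) (U := U) (w := w) Finset.subset_union_right
    (fun x hx => (hv x (hR x hx)).1)
    (fun x hx => (hv x (hR x (Finset.mem_union_right _ hx))).2.2.2 (hUU x hx))
    (fun i hi j hj h => WordClass.fac_injective (by rw [hfac i hi, hfac j hj, h]))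
    (fun x hx => (hv x (hR x hx)).2.1)
    (fun x hx => by
      rcases Finset.mem_union.1 hx with h | h
      · have hm : μ x ∈ U := Finset.mem_image_of_mem μ h
        refine ⟨μ x, hm, ?_⟩
        rw [← hfac x hx, ← hfac _ (Finset.mem_union_right _ hm)]
        exact (hμ x (hF h)).2
      · exact ⟨x, h, Set.Subset.rfl⟩))).exists
  have := add_le_factorial_sq hdc hc hc1 (e := e) (r := r) (by omega) hu hk
  rw [Finset.card_sdiff_add_card_eq_card Finset.subset_union_right] at this
  exact (Finset.card_le_card Finset.subset_union_left).trans this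

end InfWord

theorem theorem1p1 {α : Type*} [Finite α] (w : ℕ → α) (C : ℝ)
    (hC : ∀ n : ℕ, 1 ≤ n → (InfWord.complexity w n : ℝ) ≤ C * n) :
    (InfWord.RecSpec w).Finite ∧
    ((InfWord.RecSpec w).ncard : EReal) ≤
      InfWord.limsupDiff w + (((Nat.factorial ⌈C⌉₊) ^ 2 : ℕ) : EReal) ∧
    (InfWord.URecSpec w).Finite ∧
    ((InfWord.URecSpec w).ncard : EReal) ≤
      InfWord.limsupDiff w + 1 + ((C ^ 2 : ℝ) : EReal) := by
  obtain ⟨d, hdC, hev, hfreq⟩ := InfWord.exists_liminf_diff hC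
  have hL := InfWord.natCast_le_limsupDiff hev
  have hC1 : (InfWord.complexity w 1 : ℝ) ≤ C := by simpa using hC 1 le_rfl
  have hpos : (1 : ℝ) ≤ InfWord.complexity w 1 := by exact_mod_cast InfWord.complexity_pos w 1
  have hceil : 1 ≤ ⌈C⌉₊ := Nat.one_le_ceil_iff.2 (by linarith)
  have hdc : d ≤ ⌈C⌉₊ := by exact_mod_cast hdC.trans (Nat.le_ceil C)
  -- When `C ≤ 1` only one letter occurs, so the complexity is constantly `1`.
  have hone : ⌈C⌉₊ = 1 → d = 0 := by
    intro h
    have hle : C ≤ 1 := by simpa [h] using Nat.le_ceil C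
    have h1 : InfWord.complexity w 1 ≤ 1 := by exact_mod_cast hC1.trans hle
    obtain ⟨n, hn⟩ := hfreq.exists
    have := InfWord.complexity_le_one w h1 (n + 1)
    have := InfWord.complexity_pos w n
    omega
  obtain ⟨hRf, hR⟩ := InfWord.finite_and_ncard_le fun F hF =>
    InfWord.card_le_of_subset_recSpec hfreq hdc hceil hone hF
  obtain ⟨hUf, hU⟩ := InfWord.finite_and_ncard_le fun F hF =>
    InfWord.card_le_of_subset_uRecSpec hfreq hF
  refine ⟨hRf, ?_, hUf, ?_⟩
  · calc ((InfWord.RecSpec w).ncard : EReal) ≤ ((d + ⌈C⌉₊.factorial ^ 2 : ℕ) : EReal) := by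
          exact_mod_cast hR
      _ = (d : EReal) + ((⌈C⌉₊.factorial ^ 2 : ℕ) : EReal) := by push_cast; rfl
      _ ≤ _ := add_le_add_left hL _
  · calc ((InfWord.URecSpec w).ncard : EReal) ≤ ((d + 1 : ℕ) : EReal) := by
          exact_mod_cast hU
      _ = (d : EReal) + 1 := by push_cast; rfl
      _ ≤ InfWord.limsupDiff w + 1 := add_le_add_left hL _
      _ ≤ _ := le_add_of_nonneg_right (EReal.coe_nonneg.2 (sq_nonneg C))
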